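/- Let $0<q<1$, and write $(x;q)_n=\prod_{k=0}^{n-1}(1-xq^k)$ for $n\ge 0$, $(x;q)_\infty=\prod_{k=0}^{\infty}(1-xq^k)$, $(x_1,\dots,x_m;q)_n=(x_1;q)_n\cdots(x_m;q)_n$ (for $n$ a non-negative integer or $\infty$), and $${}_3\phi_2\left({x_1,x_2,x_3\atop y_1,y_2};q,z\right)=\sum_{k=0}^\infty\frac{(x_1,x_2,x_3;q)_k\,z^k}{(q,y_1,y_2;q)_k}.$$ Let $a,b,c,d,r$ be complex numbers with $\max\{|a|,|b|,|c|,|d|,|r|\}<1$, put $\alpha=a^2bcdr/q$, assume $\alpha\neq 1$, and let $\sqrt{q\alpha}$ be either square root of $q\alpha$. Then all the series below (the inner series ${}_3\phi_2$ for every $n$, the outer series on the left, and the series on the right) converge absolutely, and $$\sum_{n=0}^\infty \frac{(ab,ac,ad,ar;q)_n\,(bcdr)^n}{(q,\sqrt{q\alpha},-\sqrt{q\alpha},abcd,abcr;q)_n}\;{}_3\phi_2\left({abq^n,\,acq^n,\,bc\atop abcdq^n,\,abcrq^n};q,dr\right)$$ $$=\frac{(abdr,acdr;q)_\infty}{(dr,q\alpha;q)_\infty}\sum_{n=0}^\infty\frac{(-\alpha)^n(1-\alpha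 q^{4n})\,(\alpha,ab,ac,ad,ar;q)_{2n}\,(q;q^2)_n}{(1-\alpha)\,(q,abcd,abcr,abdr,acdr;q)_{2n}\,(q\alpha;q^2)_n}\,(bcdr)^{2n}q^{3n^2-n}.$$ -/

import Mathlib

open scoped BigOperators

/-- The finite shifted factorial `(a; q)_n = ∏_{k=0}^{n-1} (1 - a q^k)`. -/
noncomputable def qPoch (a q : ℂ) (n : ℕ) : ℂ :=
  ∏ k ∈ Finset.range n, (1 - a * q ^ k)

/-- The infinite shifted factorial `(a; q)_∞ = ∏_{k=0}^∞ (1 - a q^k)`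
(an absolutely convergent product when `|q| < 1`). -/
noncomputable def qPochInf (a q : ℂ) : ℂ :=
  ∏' k : ℕ, (1 - a * q ^ k)

/-- The multiple shifted factorial `(a_1, ..., a_m; q)_n`. -/
noncomputable def qPochs {m : ℕ} (a : Fin m → ℂ) (q : ℂ) (n : ℕ) : ℂ :=
  ∏ i, qPoch (a i) q n

/-- The multiple infinite shifted factorial `(a_1, ..., a_m; q)_∞`. -/
noncomputable def qPochsInf {m : ℕ} (a : Fin m → ℂ) (q : ℂ) : ℂ :=
  ∏ i, qPochInf (a i) q

/-- The `n`-th term of the series `_{r+1}φ_r (a_1, ..., a_{r+1}; b_1, ..., b_r; q, z)`. -/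
noncomputable def qHypTerm {r : ℕ} (a : Fin (r + 1) → ℂ) (b : Fin r → ℂ) (q z : ℂ) (n : ℕ) : ℂ :=
  qPochs a q n * z ^ n / (qPoch q q n * qPochs b q n)

/-- The basic hypergeometric series `_{r+1}φ_r (a_1, ..., a_{r+1}; b_1, ..., b_r; q, z)`. -/
noncomputable def qHyp {r : ℕ} (a : Fin (r + 1) → ℂ) (b : Fin r → ℂ) (q z : ℂ) : ℂ :=
  ∑' n : ℕ, qHypTerm a b q z n

/-- The `n`-th term of the outer series of the double series; `w` is a square root of `qα`. -/
noncomputable def doubleSeriesTerm (q a b c d r w : ℂ) (n : ℕ) : ℂ :=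
  qPochs ![a * b, a * c, a * d, a * r] q n * (b * c * d * r) ^ n
      / qPochs ![q, w, -w, a * b * c * d, a * b * c * r] q n
    * qHyp ![a * b * q ^ n, a * c * q ^ n, b * c]
        ![a * b * c * d * q ^ n, a * b * c * r * q ^ n] q (d * r)

/-- The `n`-th term of the single series on the right-hand side
(in the exponent, `n ≤ 3 n ^ 2` for every natural number `n`). -/
noncomputable def evenSeriesTerm (q a b c d r α : ℂ) (n : ℕ) : ℂ :=
  (-α) ^ n * (1 - α * q ^ (4 * n))
      * qPochs ![α, a * b, a * c, a * d, a * r] q (2 * n) * qPoch q (q ^ 2) n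
    / ((1 - α)
      * qPochs ![q, a * b * c * d, a * b * c * r, a * b * d * r, a * c * d * r] q (2 * n)
      * qPoch (q * α) (q ^ 2) n)
    * (b * c * d * r) ^ (2 * n) * q ^ (3 * n ^ 2 - n)

/-! The identity is two applications of Bailey's lemma, both relative to `α`, with `t = qα =
a²bcdr`. The seed is a Bailey pair with `B n = 1 / ((q;q)_n (qα;q²)_n)` whose `A` lives on even
indices only (`isBaileyPair_evenNumerator`); this explains the subscripts `2n` on the right of the
theorem.

Write the left side as a double sum over `(n, k)`, using `(w;q)_n (-w;q)_n = (qα;q²)_n`, and group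
by `N = n + k`. Each antidiagonal is `(ab, ac;q)_N (dr)^N` times the `B` obtained from the seed by
`IsBaileyPair.next` with `(x, y, e) = (ad, ar, bc)` (`sum_antidiagonal_doubleSummand`). The limiting
lemma `IsBaileyPair.tsum_eq` with `(x, y, e) = (ab, ac, dr)` then sums over `N` and produces the
infinite products.

Bailey's lemma rests on the q-Pfaff–Saalschütz sum. That sum and the seed are both proved by
telescoping a first-order recurrence. All convergence comes from uniformly bounded shifted
factorials times geometric factors; over `ℂ`, `Summable` is absolute convergence. -/

theorem qPoch_zero (a q : ℂ) : qPoch a q 0 = 1 := by simp [qPoch]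

theorem qPoch_succ (a q : ℂ) (n : ℕ) : qPoch a q (n + 1) = qPoch a q n * (1 - a * q ^ n) := by
  simp [qPoch, Finset.prod_range_succ]

theorem qPoch_add (a q : ℂ) (m n : ℕ) :
    qPoch a q (m + n) = qPoch a q m * qPoch (a * q ^ m) q n := by
  simp [qPoch, Finset.prod_range_add, pow_add, mul_assoc]

theorem one_sub_mul_pow_ne_zero {a q : ℂ} (ha : ‖a‖ < 1) (hq : ‖q‖ < 1) (n : ℕ) :
    1 - a * q ^ n ≠ 0 := by
  intro h
  have h1 : ‖a * q ^ n‖ = 1 := by rw [← sub_eq_zero.mp h]; simp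
  rw [norm_mul, norm_pow] at h1
  have h2 : ‖q‖ ^ n ≤ 1 := pow_le_one₀ (norm_nonneg _) hq.le
  nlinarith [norm_nonneg a, norm_nonneg q]

theorem qPoch_ne_zero {a q : ℂ} (ha : ‖a‖ < 1) (hq : ‖q‖ < 1) (n : ℕ) : qPoch a q n ≠ 0 :=
  Finset.prod_ne_zero_iff.mpr fun k _ => one_sub_mul_pow_ne_zero ha hq k

/-! ### The q-Pfaff–Saalschütz sum -/

/-- The summand of the `q`-Pfaff–Saalschütz sum, in a form free of negative powers. -/
noncomputable def saalTerm (q x y e : ℂ) (M k : ℕ) : ℂ :=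
  qPoch x q k * qPoch y q k * qPoch e q (M - k) * e ^ k
    / (qPoch q q (M - k) * qPoch q q k * qPoch (x * y * e) q k)

theorem saalTerm_add (q x y e : ℂ) (L k : ℕ) :
    saalTerm q x y e (k + L) k = qPoch x q k * qPoch y q k * qPoch e q L * e ^ k
    / (qPoch q q L * qPoch q q k * qPoch (x * y * e) q k) := by
  simp [saalTerm]

/-- With `M = K + L`, this is a telescoping certificate for the first-order recurrence in `M`
satisfied by the Saalschütz sum. The slack `L` replaces `M - K`, and the induction step uses `L + 1`
so that `M` stays fixed while `K` grows. -/
theorem saalTerm_telescope {q x y e : ℂ} (hq : ‖q‖ < 1) (ht : ‖x * y * e‖ < 1) (K L : ℕ) :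
    ∑ k ∈ Finset.range (K + 1),
      ((1 - q ^ (K + L + 1)) * (1 - x * y * e * q ^ (K + L)) * saalTerm q x y e (K + L + 1) k
        - (1 - x * e * q ^ (K + L)) * (1 - y * e * q ^ (K + L)) * saalTerm q x y e (K + L) k)
      = -e * q ^ L * (1 - x * q ^ K) * (1 - y * q ^ K) * saalTerm q x y e (K + L) K := by
  induction K generalizing L with
  | zero =>
    have h1 := one_sub_mul_pow_ne_zero hq hq L
    have h2 := qPoch_ne_zero hq hq L
    have e1 : saalTerm q x y e (0 + L + 1) 0 = qPoch e q (L + 1) / qPoch q q (L + 1) := by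
      simp [saalTerm, qPoch_zero]
    have e2 : saalTerm q x y e (0 + L) 0 = qPoch e q L / qPoch q q L := by
      simp [saalTerm, qPoch_zero]
    simp only [zero_add, Finset.range_one, Finset.sum_singleton, pow_zero, mul_one] at e1 e2 ⊢
    rw [e1, e2, qPoch_succ, qPoch_succ, pow_succ' q L]
    generalize q ^ L = Q at *
    field_simp
    ring
  | succ K ih =>
    rw [Finset.sum_range_succ]
    have h := ih (L + 1)
    rw [show K + (L + 1) = K + 1 + L by ring] at h
    rw [h]
    have e1 := saalTerm_add q x y e (L + 1) K
    rw [show K + (L + 1) = K + 1 + L by ring] at e1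
    have e2 := saalTerm_add q x y e L (K + 1)
    have e3 : saalTerm q x y e (K + 1 + L + 1) (K + 1) = _ := saalTerm_add q x y e (L + 1) (K + 1)
    rw [e1, e2, e3]
    have h1 := one_sub_mul_pow_ne_zero hq hq L
    have h2 := qPoch_ne_zero hq hq L
    have h3 := one_sub_mul_pow_ne_zero hq hq K
    have h4 := qPoch_ne_zero hq hq K
    have h5 := one_sub_mul_pow_ne_zero ht hq K
    have h6 := qPoch_ne_zero ht hq K
    simp only [qPoch_succ]
    clear e1 e2 e3 h ih
    -- The nonzero factors become atoms so that `field_simp` can cancel them; they are expanded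
    -- again for the final polynomial identity.
    generalize hu1 : 1 - q * q ^ L = u1 at *
    generalize hu2 : 1 - q * q ^ K = u2 at *
    generalize hu3 : 1 - x * y * e * q ^ K = u3 at *
    generalize qPoch (x * y * e) q K = T at *
    field_simp
    rw [← hu1, ← hu2, ← hu3]
    ring

/-- The `q`-Pfaff–Saalschütz summation. -/
theorem sum_saalTerm {q x y e : ℂ} (hq : ‖q‖ < 1) (ht : ‖x * y * e‖ < 1) (M : ℕ) :
    ∑ k ∈ Finset.range (M + 1), saalTerm q x y e M k
      = qPoch (x * e) q M * qPoch (y * e) q M / (qPoch q q M * qPoch (x * y * e) q M) := by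
  induction M with
  | zero => simp [saalTerm, qPoch_zero]
  | succ M ih =>
    -- With no slack the certificate covers `k ≤ M`; the top term `k = M + 1` is added separately.
    have h := saalTerm_telescope hq ht M 0
    have e1 := saalTerm_add q x y e 0 M
    have e2 := saalTerm_add q x y e 0 (M + 1)
    simp only [add_zero] at h e1 e2
    rw [Finset.sum_sub_distrib, ← Finset.mul_sum, ← Finset.mul_sum, ih, e1] at h
    rw [Finset.sum_range_succ, e2]
    have h3 := one_sub_mul_pow_ne_zero hq hq M
    have h4 := qPoch_ne_zero hq hq M
    have h5 := one_sub_mul_pow_ne_zero ht hq M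
    have h6 := qPoch_ne_zero ht hq M
    have h7 : (1 - q ^ (M + 1)) ≠ 0 := by rw [pow_succ']; exact h3
    have h8 : ∑ k ∈ Finset.range (M + 1), saalTerm q x y e (M + 1) k
      = ((1 - x * e * q ^ M) * (1 - y * e * q ^ M) *
        (qPoch (x * e) q M * qPoch (y * e) q M / (qPoch q q M * qPoch (x * y * e) q M))
        + -e * q ^ 0 * (1 - x * q ^ M) * (1 - y * q ^ M) *
         (qPoch x q M * qPoch y q M * qPoch e q 0 * e ^ M
            / (qPoch q q 0 * qPoch q q M * qPoch (x * y * e) q M)))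
        / ((1 - q ^ (M + 1)) * (1 - x * y * e * q ^ M)) := by
      rw [eq_div_iff (mul_ne_zero h7 h5)]
      linear_combination h
    rw [h8]
    simp only [qPoch_succ, qPoch_zero]
    rw [pow_succ' q M]
    field_simp
    ring

/-! ### Bailey pairs and Bailey's lemma -/

/-- `(A, B)` is a Bailey pair relative to `t / q`. -/
def IsBaileyPair (q t : ℂ) (A B : ℕ → ℂ) : Prop :=
  ∀ n, B n = ∑ m ∈ Finset.range (n + 1), A m / (qPoch q q (n - m) * qPoch t q (n + m))

/-- The inner sum of Bailey's lemma after the order of summation is exchanged: splitting off the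
first `m` factors leaves a Saalschütz sum with `x`, `y` replaced by `x q^m`, `y q^m`. -/
theorem sum_saalTerm_shift {q x y e : ℂ} (hq : ‖q‖ < 1) (ht : ‖x * y * e‖ < 1)
    (hx : ‖x * e‖ < 1) (hy : ‖y * e‖ < 1) (m M : ℕ) :
    ∑ k ∈ Finset.range (M + 1), qPoch x q (m + k) * qPoch y q (m + k) * qPoch e q (M - k)
        * e ^ (m + k) / (qPoch q q (M - k) * (qPoch q q k * qPoch (x * y * e) q (m + k + m)))
      = qPoch (x * e) q (m + M) * qPoch (y * e) q (m + M) * (qPoch x q m * qPoch y q m * e ^ m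
        / (qPoch (x * e) q m * qPoch (y * e) q m)
        / (qPoch q q M * qPoch (x * y * e) q (m + M + m))) := by
  have hqm : ‖q ^ m‖ ≤ 1 := by rw [norm_pow]; exact pow_le_one₀ (norm_nonneg _) hq.le
  have hE : (x * q ^ m) * (y * q ^ m) * e = x * y * e * q ^ (m + m) := by ring
  have ht' : ‖(x * q ^ m) * (y * q ^ m) * e‖ < 1 := by
    rw [show (x * q ^ m) * (y * q ^ m) * e = x * y * e * (q ^ m * q ^ m) by ring, norm_mul,
      norm_mul (q ^ m)]
    have := mul_le_one₀ hqm (norm_nonneg _) hqm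
    nlinarith [norm_nonneg (x * y * e), norm_nonneg (q ^ m)]
  have key := sum_saalTerm (q := q) (x := x * q ^ m) (y := y * q ^ m) (e := e) hq ht' M
  have h1 := qPoch_ne_zero ht hq (m + m)
  have h2 := qPoch_ne_zero hx hq m
  have h3 := qPoch_ne_zero hy hq m
  have L : ∀ k, qPoch x q (m + k) * qPoch y q (m + k) * qPoch e q (M - k)
        * e ^ (m + k) / (qPoch q q (M - k) * (qPoch q q k * qPoch (x * y * e) q (m + k + m)))
      = (qPoch x q m * qPoch y q m * e ^ m / qPoch (x * y * e) q (m + m)) *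
        saalTerm q (x * q ^ m) (y * q ^ m) e M k := by
    intro k
    rw [saalTerm, hE, show m + k + m = m + m + k by ring, qPoch_add x, qPoch_add y,
      qPoch_add (x * y * e) q (m + m), pow_add e]
    field_simp
  rw [Finset.sum_congr rfl fun k _ => L k, ← Finset.mul_sum, key, hE,
    show m + M + m = m + m + M by ring, qPoch_add (x * e), qPoch_add (y * e),
      qPoch_add (x * y * e) q (m + m), show x * q ^ m * e = x * e * q ^ m by ring,
      show y * q ^ m * e = y * e * q ^ m by ring]
  field_simp

/-- Bailey's lemma, finite form. -/
theorem IsBaileyPair.sum_eq {q x y e : ℂ} {A B : ℕ → ℂ} (hq : ‖q‖ < 1) (ht : ‖x * y * e‖ < 1)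
    (hx : ‖x * e‖ < 1) (hy : ‖y * e‖ < 1) (h : IsBaileyPair q (x * y * e) A B) (N : ℕ) :
    ∑ n ∈ Finset.range (N + 1), qPoch x q n * qPoch y q n * e ^ n * B n
        * (qPoch e q (N - n) / qPoch q q (N - n))
      = qPoch (x * e) q N * qPoch (y * e) q N * ∑ m ∈ Finset.range (N + 1),
        qPoch x q m * qPoch y q m * e ^ m / (qPoch (x * e) q m * qPoch (y * e) q m) * A m
          / (qPoch q q (N - m) * qPoch (x * y * e) q (N + m)) := by
  have h1 : ∀ n ∈ Finset.range (N + 1), qPoch x q n * qPoch y q n * e ^ n * B n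
        * (qPoch e q (N - n) / qPoch q q (N - n)) = ∑ m ∈ Finset.range (n + 1),
        A m * (qPoch x q n * qPoch y q n * qPoch e q (N - n) * e ^ n /
          (qPoch q q (N - n) * (qPoch q q (n - m) * qPoch (x * y * e) q (n + m)))) := by
    intro n _
    rw [h n, Finset.mul_sum, Finset.sum_mul]
    refine Finset.sum_congr rfl fun m _ => ?_
    have := qPoch_ne_zero hq hq (N - n)
    have := qPoch_ne_zero hq hq (n - m)
    have := qPoch_ne_zero ht hq (n + m)
    field_simp
  rw [Finset.sum_congr rfl h1, Finset.mul_sum,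
    Finset.sum_comm' (t' := Finset.range (N + 1)) (s' := fun m => Finset.Ico m (N + 1))
      (h := by intro n m; simp only [Finset.mem_range, Finset.mem_Ico]; omega)]
  refine Finset.sum_congr rfl fun m hm => ?_
  obtain ⟨M, rfl⟩ := Nat.exists_eq_add_of_le (Nat.lt_succ_iff.mp (Finset.mem_range.mp hm))
  have key := sum_saalTerm_shift hq ht hx hy m M
  rw [← Finset.mul_sum, Finset.sum_Ico_eq_sum_range, show m + M + 1 - m = M + 1 by omega]
  simp only [Nat.add_sub_add_left, Nat.add_sub_cancel_left]
  rw [key]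
  ring

/-- Bailey's lemma: from a Bailey pair a new one is obtained. -/
theorem IsBaileyPair.next {q t x y e : ℂ} {A B : ℕ → ℂ} (hxy : t = x * y * e) (hq : ‖q‖ < 1)
    (ht : ‖t‖ < 1) (hx : ‖x * e‖ < 1) (hy : ‖y * e‖ < 1) (h : IsBaileyPair q t A B) :
    IsBaileyPair q t
      (fun m => qPoch x q m * qPoch y q m * e ^ m / (qPoch (x * e) q m * qPoch (y * e) q m) * A m)
      (fun N => (∑ n ∈ Finset.range (N + 1), qPoch x q n * qPoch y q n * e ^ n * B n
        * (qPoch e q (N - n) / qPoch q q (N - n))) / (qPoch (x * e) q N * qPoch (y * e) q N)) := by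
  subst hxy
  intro N
  have h2 := qPoch_ne_zero hx hq N
  have h3 := qPoch_ne_zero hy hq N
  simp only
  rw [h.sum_eq hq ht hx hy, mul_div_cancel_left₀ _ (mul_ne_zero h2 h3)]

/-! ### The initial Bailey pair -/

/-- The summand of the quadratic `₆φ₅` sum underlying the initial Bailey pair. -/
noncomputable def quadTerm (q α : ℂ) (n j : ℕ) : ℂ :=
  (-α) ^ j * q ^ (3 * j ^ 2 - j) * (1 - α * q ^ (4 * j)) * qPoch α (q ^ 2) j
    / ((1 - α) * qPoch (q ^ 2) (q ^ 2) j)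
    / (qPoch q q (n - 2 * j) * qPoch (q * α) q (n + 2 * j))

theorem quadTerm_add (q α : ℂ) (j L : ℕ) :
    quadTerm q α (2 * j + L) j = (-α) ^ j * q ^ (3 * j ^ 2 - j) * (1 - α * q ^ (4 * j))
      * qPoch α (q ^ 2) j / ((1 - α) * qPoch (q ^ 2) (q ^ 2) j)
      / (qPoch q q L * qPoch (q * α) q (4 * j + L)) := by
  rw [quadTerm, show 2 * j + L - 2 * j = L by omega, show 2 * j + L + 2 * j = 4 * j + L by ring]

theorem quad_exponent_succ (j : ℕ) : 3 * (j + 1) ^ 2 - (j + 1) = 3 * j ^ 2 - j + (6 * j + 2) := by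
  have : j ≤ 3 * j ^ 2 := by nlinarith [Nat.zero_le j, Nat.le_self_pow (n := 2) (by norm_num) j]
  zify [this, show j + 1 ≤ 3 * (j + 1) ^ 2 by nlinarith]
  ring

/-- Only `qα` is known to lie in the unit disc, so `j = 0` needs `α ≠ 1`, while for `j > 0` one
factor `q` is absorbed into `α`. -/
theorem one_sub_mul_pow_four_ne_zero {q α : ℂ} (hq : ‖q‖ < 1) (hα : ‖q * α‖ < 1) (hα1 : α ≠ 1)
    (j : ℕ) : 1 - α * q ^ (4 * j) ≠ 0 := by
  cases j with
  | zero => simpa [sub_eq_zero] using hα1.symm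
  | succ j =>
    have := one_sub_mul_pow_ne_zero hα hq (4 * j + 3)
    rwa [show q * α * q ^ (4 * j + 3) = α * q ^ (4 * (j + 1)) by ring] at this

/-- The certificate, with `n = 2j + L`, for the recurrence `(1 - q^(n+1)) (1 - α q^(2n+1)) S (n+1) =
S n`, where `S n` is the sum of `quadTerm q α n`. The factor `1 - q^L` makes it vanish at `L = 0`.
-/
theorem quadTerm_telescope {q α : ℂ} (hq : ‖q‖ < 1) (hα : ‖q * α‖ < 1) (hα1 : α ≠ 1) (j L : ℕ) :
    ∑ i ∈ Finset.range (j + 1), ((1 - q ^ (2 * j + L + 1)) * (1 - α * q ^ (2 * (2 * j + L) + 1))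
        * quadTerm q α (2 * j + L + 1) i - quadTerm q α (2 * j + L) i)
      = α * q ^ (6 * j + L + 1) * (1 - α * q ^ (2 * j)) * (1 - q ^ L)
        / ((1 - α * q ^ (4 * j)) * (1 - q * α * q ^ (4 * j + L))) * quadTerm q α (2 * j + L) j := by
  have hq2 : ‖q ^ 2‖ < 1 := by rw [norm_pow]; exact pow_lt_one₀ (norm_nonneg _) hq (by norm_num)
  have hα0 : 1 - α ≠ 0 := sub_ne_zero.mpr hα1.symm
  induction j generalizing L with
  | zero =>
    have e1 := quadTerm_add q α 0 L
    have e2 := quadTerm_add q α 0 (L + 1)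
    simp only [mul_zero, zero_add, ← add_assoc, pow_zero, qPoch_zero, mul_one,
      Finset.range_one, Finset.sum_singleton] at e1 e2 ⊢
    rw [e1, e2, qPoch_succ, qPoch_succ]
    simp only [ne_eq, OfNat.ofNat_ne_zero, not_false_eq_true, zero_pow, mul_zero, Nat.zero_sub,
      pow_zero]
    have h1 := one_sub_mul_pow_ne_zero hq hq L
    have h2 := qPoch_ne_zero hq hq L
    have h3 := one_sub_mul_pow_ne_zero hα hq L
    have h4 := qPoch_ne_zero hα hq L
    generalize hu1 : 1 - q * q ^ L = u1 at *
    generalize hu2 : 1 - q * α * q ^ L = u2 at *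
    field_simp
    rw [← hu1, ← hu2]
    ring
  | succ j ih =>
    rw [Finset.sum_range_succ]
    have h := ih (L + 2)
    rw [show 2 * j + (L + 2) = 2 * (j + 1) + L by ring] at h
    rw [h]
    have e1 := quadTerm_add q α j (L + 2)
    rw [show 2 * j + (L + 2) = 2 * (j + 1) + L by ring] at e1
    have e2 := quadTerm_add q α (j + 1) L
    have e3 : quadTerm q α (2 * (j + 1) + L + 1) (j + 1) = _ := quadTerm_add q α (j + 1) (L + 1)
    rw [e1, e2, e3, quad_exponent_succ]
    have h1 := one_sub_mul_pow_ne_zero hq hq L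
    have h1' := one_sub_mul_pow_ne_zero hq hq (L + 1)
    have h2 := qPoch_ne_zero hq hq L
    have h3 := one_sub_mul_pow_ne_zero hα hq (4 * j + L + 2)
    have h3' := one_sub_mul_pow_ne_zero hα hq (4 * j + L + 2 + 1)
    have h3'' := one_sub_mul_pow_ne_zero hα hq (4 * j + L + 2 + 1 + 1)
    have h4 := qPoch_ne_zero hα hq (4 * j + L + 2)
    have h5 := one_sub_mul_pow_ne_zero hq2 hq2 j
    have h6 := qPoch_ne_zero hq2 hq2 j
    have h7 := one_sub_mul_pow_four_ne_zero hq hα hα1 j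
    have h8 := one_sub_mul_pow_four_ne_zero hq hα hα1 (j + 1)
    rw [show 4 * (j + 1) + (L + 1) = 4 * j + L + 2 + 1 + 1 + 1 by ring,
      show 4 * (j + 1) + L = 4 * j + L + 2 + 1 + 1 by ring,
      show 4 * j + (L + 2) = 4 * j + L + 2 by ring, qPoch_succ _ _ (4 * j + L + 2 + 1 + 1),
      qPoch_succ _ _ (4 * j + L + 2 + 1), qPoch_succ _ _ (4 * j + L + 2)]
    generalize qPoch (q * α) q (4 * j + L + 2) = P at *
    simp only [qPoch_succ, pow_succ (-α) j, pow_add _ (3 * j ^ 2 - j)]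
    generalize q ^ (3 * j ^ 2 - j) = E at *
    generalize (-α) ^ j = F at *
    generalize qPoch (q ^ 2) (q ^ 2) j = R at *
    generalize qPoch α (q ^ 2) j = S at *
    generalize qPoch q q L = T at *
    clear ih h e1 e2 e3
    generalize hu1 : 1 - q * q ^ L = u1 at *
    generalize hu2 : 1 - q * q ^ (L + 1) = u2 at *
    generalize hu3 : 1 - q * α * q ^ (4 * j + L + 2) = u3 at *
    generalize hu4 : 1 - q * α * q ^ (4 * j + L + 2 + 1) = u4 at *
    generalize hu5 : 1 - q * α * q ^ (4 * j + L + 2 + 1 + 1) = u5 at *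
    generalize hu6 : 1 - q ^ 2 * (q ^ 2) ^ j = u6 at *
    generalize hu7 : 1 - α * q ^ (4 * j) = u7 at *
    generalize hu8 : 1 - α * q ^ (4 * (j + 1)) = u8 at *
    field_simp
    simp only [← hu1, ← hu2, ← hu4, ← hu5, ← hu6, ← hu8]
    ring

/-- For odd `n` the range of summation gains an index on passing to `n + 1`; the new term cancels
the remainder that the certificate leaves at `L = 1`. -/
theorem quadTerm_last {q α : ℂ} (hq : ‖q‖ < 1) (hα : ‖q * α‖ < 1) (hα1 : α ≠ 1) (j : ℕ) :
    (1 - q ^ (2 * j + 1 + 1)) * (1 - α * q ^ (2 * (2 * j + 1) + 1))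
        * quadTerm q α (2 * j + 1 + 1) (j + 1) +
       α * q ^ (6 * j + 1 + 1) * (1 - α * q ^ (2 * j)) * (1 - q ^ 1)
        / ((1 - α * q ^ (4 * j)) * (1 - q * α * q ^ (4 * j + 1))) * quadTerm q α (2 * j + 1) j
      = 0 := by
  have hq2 : ‖q ^ 2‖ < 1 := by rw [norm_pow]; exact pow_lt_one₀ (norm_nonneg _) hq (by norm_num)
  have hα0 : 1 - α ≠ 0 := sub_ne_zero.mpr hα1.symm
  have e1 := quadTerm_add q α j 1
  have e2 : quadTerm q α (2 * j + 1 + 1) (j + 1) = _ := quadTerm_add q α (j + 1) 0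
  rw [e1, e2, quad_exponent_succ]
  have h1 := one_sub_mul_pow_ne_zero hq hq 0
  have h3 := one_sub_mul_pow_ne_zero hα hq (4 * j + 1)
  have h3' := one_sub_mul_pow_ne_zero hα hq (4 * j + 1 + 1)
  have h3'' := one_sub_mul_pow_ne_zero hα hq (4 * j + 1 + 1 + 1)
  have h4 := qPoch_ne_zero hα hq (4 * j + 1)
  have h5 := one_sub_mul_pow_ne_zero hq2 hq2 j
  have h6 := qPoch_ne_zero hq2 hq2 j
  have h7 := one_sub_mul_pow_four_ne_zero hq hα hα1 j
  rw [show 4 * (j + 1) + 0 = 4 * j + 1 + 1 + 1 + 1 by ring, show qPoch q q 1 = 1 - q by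
    simp [qPoch], qPoch_succ _ _ (4 * j + 1 + 1 + 1), qPoch_succ _ _ (4 * j + 1 + 1),
    qPoch_succ _ _ (4 * j + 1)]
  generalize qPoch (q * α) q (4 * j + 1) = P at *
  simp only [qPoch_succ, qPoch_zero, pow_succ (-α) j, pow_add _ (3 * j ^ 2 - j)]
  generalize q ^ (3 * j ^ 2 - j) = E at *
  generalize (-α) ^ j = F at *
  generalize qPoch (q ^ 2) (q ^ 2) j = R at *
  generalize qPoch α (q ^ 2) j = S at *
  clear e1 e2
  rw [pow_zero, mul_one] at h1
  generalize hu1 : 1 - q = u1 at *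
  generalize hu3 : 1 - q * α * q ^ (4 * j + 1) = u3 at *
  generalize hu4 : 1 - q * α * q ^ (4 * j + 1 + 1) = u4 at *
  generalize hu5 : 1 - q * α * q ^ (4 * j + 1 + 1 + 1) = u5 at *
  generalize hu6 : 1 - q ^ 2 * (q ^ 2) ^ j = u6 at *
  generalize hu7 : 1 - α * q ^ (4 * j) = u7 at *
  field_simp
  simp only [← hu1, ← hu3, ← hu4, ← hu5, ← hu6]
  ring

theorem sum_quadTerm {q α : ℂ} (hq : ‖q‖ < 1) (hα : ‖q * α‖ < 1) (hα1 : α ≠ 1) (n : ℕ) :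
    ∑ j ∈ Finset.range (n / 2 + 1), quadTerm q α n j
      = 1 / (qPoch q q n * qPoch (q * α) (q ^ 2) n) := by
  have hq2 : ‖q ^ 2‖ < 1 := by rw [norm_pow]; exact pow_lt_one₀ (norm_nonneg _) hq (by norm_num)
  have hα0 : 1 - α ≠ 0 := sub_ne_zero.mpr hα1.symm
  induction n with
  | zero => simp [quadTerm, qPoch_zero, hα0]
  | succ n ih =>
    have h : (1 - q ^ (n + 1)) * (1 - α * q ^ (2 * n + 1)) *
        ∑ j ∈ Finset.range ((n + 1) / 2 + 1), quadTerm q α (n + 1) j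
        = ∑ j ∈ Finset.range (n / 2 + 1), quadTerm q α n j := by
      -- Even `n` takes `L = 0`, where the remainder is zero; odd `n` takes `L = 1` and needs the
      -- extra top term.
      rcases Nat.even_or_odd' n with ⟨j, rfl | rfl⟩
      · have h := quadTerm_telescope hq hα hα1 j 0
        simp only [add_zero, pow_zero, sub_self, mul_zero, zero_div, zero_mul] at h
        rw [Finset.sum_sub_distrib, ← Finset.mul_sum, sub_eq_zero] at h
        rw [show (2 * j + 1) / 2 = j by omega, show 2 * j / 2 = j by omega, h]
      · have h := quadTerm_telescope hq hα hα1 j 1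
        have h' := quadTerm_last hq hα hα1 j
        rw [Finset.sum_sub_distrib, ← Finset.mul_sum] at h
        rw [show (2 * j + 1 + 1) / 2 = j + 1 by omega, show (2 * j + 1) / 2 = j by omega,
          Finset.sum_range_succ]
        linear_combination h + h'
    have h1 := one_sub_mul_pow_ne_zero hq hq n
    have h2 := qPoch_ne_zero hq hq n
    have h3 := one_sub_mul_pow_ne_zero hα hq2 n
    have h4 := qPoch_ne_zero hα hq2 n
    rw [ih] at h
    rw [qPoch_succ, qPoch_succ, eq_div_iff (by simp [*])]
    rw [eq_div_iff (by simp [*])] at h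
    linear_combination h

/-- The numerator sequence of the initial Bailey pair; it vanishes at odd indices. -/
noncomputable def evenNumerator (q α : ℂ) (m : ℕ) : ℂ :=
  if Even m then (-α) ^ (m / 2) * q ^ (3 * (m / 2) ^ 2 - m / 2) * (1 - α * q ^ (4 * (m / 2)))
    * qPoch α (q ^ 2) (m / 2) / ((1 - α) * qPoch (q ^ 2) (q ^ 2) (m / 2)) else 0

theorem isBaileyPair_evenNumerator {q α : ℂ} (hq : ‖q‖ < 1) (hα : ‖q * α‖ < 1) (hα1 : α ≠ 1) :
    IsBaileyPair q (q * α) (evenNumerator q α)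
      (fun n => 1 / (qPoch q q n * qPoch (q * α) (q ^ 2) n)) := by
  intro n
  simp only
  rw [← sum_quadTerm hq hα hα1]
  have hi : Function.Injective (fun j : ℕ => 2 * j) := fun a b h => by simpa using h
  have hs : Finset.image (fun j => 2 * j) (Finset.range (n / 2 + 1)) ⊆ Finset.range (n + 1) := by
    intro m hm
    simp only [Finset.mem_image, Finset.mem_range] at hm ⊢
    omega
  rw [← Finset.sum_subset hs, Finset.sum_image hi.injOn]
  · refine Finset.sum_congr rfl fun j _ => ?_
    simp [evenNumerator, quadTerm]
  · intro m hm hm'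
    have : ¬ Even m := by
      rintro ⟨k, rfl⟩
      apply hm'
      simp only [Finset.mem_image, Finset.mem_range] at hm ⊢
      exact ⟨k, by omega, by omega⟩
    simp [evenNumerator, this]

/-! ### Infinite products, uniform bounds and the limiting Bailey lemma -/

theorem summable_norm_neg_mul_pow (a : ℂ) {q : ℂ} (hq : ‖q‖ < 1) :
    Summable (fun n : ℕ => ‖-(a * q ^ n)‖) := by
  simp only [norm_neg, norm_mul, norm_pow]
  exact (summable_geometric_of_lt_one (norm_nonneg _) hq).mul_left _

theorem tendsto_qPoch (a : ℂ) {q : ℂ} (hq : ‖q‖ < 1) :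
    Filter.Tendsto (qPoch a q) Filter.atTop (nhds (qPochInf a q)) := by
  have h := (multipliable_one_add_of_summable (summable_norm_neg_mul_pow a hq)).hasProd.tendsto_prod_nat
  simp only [← sub_eq_add_neg] at h
  exact h

theorem qPochInf_ne_zero {a q : ℂ} (ha : ‖a‖ < 1) (hq : ‖q‖ < 1) : qPochInf a q ≠ 0 := by
  have h := tprod_one_add_ne_zero_of_summable (f := fun n : ℕ => -(a * q ^ n))
    (fun n => by simpa only [← sub_eq_add_neg] using one_sub_mul_pow_ne_zero ha hq n)
    (summable_norm_neg_mul_pow a hq)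
  simp only [← sub_eq_add_neg] at h
  exact h

/-- A uniformly bounded family of complex numbers. -/
def BoundedFamily {ι : Type*} (f : ι → ℂ) : Prop := ∃ C, ∀ i, ‖f i‖ ≤ C

namespace BoundedFamily

variable {ι κ : Type*} {f g : ι → ℂ}

theorem mul (hf : BoundedFamily f) (hg : BoundedFamily g) : BoundedFamily (fun i => f i * g i) := by
  obtain ⟨C, hC⟩ := hf
  obtain ⟨D, hD⟩ := hg
  refine ⟨C * D, fun i => ?_⟩
  rw [norm_mul]
  exact mul_le_mul (hC i) (hD i) (norm_nonneg _) ((norm_nonneg _).trans (hC i))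

theorem comp (hf : BoundedFamily f) (u : κ → ι) : BoundedFamily (fun k => f (u k)) :=
  hf.imp fun _ h k => h (u k)

theorem of_tendsto {f : ℕ → ℂ} {l : ℂ} (h : Filter.Tendsto f Filter.atTop (nhds l)) :
    BoundedFamily f := by
  obtain ⟨C, hC⟩ := h.norm.bddAbove_range
  exact ⟨C, fun n => hC ⟨n, rfl⟩⟩

theorem qPoch (a : ℂ) {q : ℂ} (hq : ‖q‖ < 1) (u : ι → ℕ) :
    BoundedFamily (fun i => qPoch a q (u i)) :=
  (of_tendsto (tendsto_qPoch a hq)).comp u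

/-- The infinite product is nonzero, so the reciprocals converge too and are therefore bounded. -/
theorem inv_qPoch {a q : ℂ} (ha : ‖a‖ < 1) (hq : ‖q‖ < 1) (u : ι → ℕ) :
    BoundedFamily (fun i => (_root_.qPoch a q (u i))⁻¹) :=
  (of_tendsto ((tendsto_qPoch a hq).inv₀ (qPochInf_ne_zero ha hq))).comp u

theorem summable_mul (hf : BoundedFamily f) (hg : Summable (fun i => ‖g i‖)) :
    Summable (fun i => f i * g i) := by
  obtain ⟨C, hC⟩ := hf
  refine Summable.of_norm_bounded (hg.mul_left C) fun i => ?_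
  rw [norm_mul]
  exact mul_le_mul_of_nonneg_right (hC i) (norm_nonneg _)

end BoundedFamily

theorem summable_norm_pow {z : ℂ} (hz : ‖z‖ < 1) : Summable (fun n : ℕ => ‖z ^ n‖) := by
  simpa only [norm_pow] using summable_geometric_of_lt_one (norm_nonneg _) hz

/-- Tannery's theorem: extend the finite sums by zero and dominate them by a multiple of `‖u n‖`. -/
theorem tendsto_sum_range_mul {u : ℕ → ℂ} {g : ℕ → ℕ → ℂ} {l : ℂ} (hu : Summable u)
    (hg : BoundedFamily (fun p : ℕ × ℕ => g p.1 p.2))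
    (hl : ∀ n, Filter.Tendsto (fun N => g N n) Filter.atTop (nhds l)) :
    Filter.Tendsto (fun N => ∑ n ∈ Finset.range (N + 1), u n * g N n) Filter.atTop
      (nhds ((∑' n, u n) * l)) := by
  obtain ⟨C, hC⟩ := hg
  have hC0 : 0 ≤ C := (norm_nonneg _).trans (hC (0, 0))
  have key := tendsto_tsum_of_dominated_convergence (𝓕 := Filter.atTop)
    (f := fun N n => if n ∈ Finset.range (N + 1) then u n * g N n else 0)
    (g := fun n => u n * l) (bound := fun n => C * ‖u n‖) (hu.norm.mul_left C) ?_ ?_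
  · rw [tsum_mul_right] at key
    refine key.congr fun N => ?_
    rw [tsum_eq_sum (s := Finset.range (N + 1)) fun n hn => if_neg hn]
    exact Finset.sum_congr rfl fun n hn => if_pos hn
  · intro n
    refine ((hl n).const_mul (u n)).congr' ?_
    filter_upwards [Filter.eventually_ge_atTop n] with N hN
    rw [if_pos (Finset.mem_range.mpr (by omega))]
  · refine Filter.Eventually.of_forall fun N n => ?_
    split_ifs
    · rw [norm_mul, mul_comm]
      exact mul_le_mul_of_nonneg_right (hC (N, n)) (norm_nonneg _)
    · rw [norm_zero]; positivity

/-- Bailey's lemma, in the limit. -/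
theorem IsBaileyPair.tsum_eq {q t x y e : ℂ} {A B : ℕ → ℂ} (hxy : t = x * y * e) (hq : ‖q‖ < 1)
    (ht : ‖t‖ < 1) (he : ‖e‖ < 1) (hx : ‖x * e‖ < 1) (hy : ‖y * e‖ < 1) (h : IsBaileyPair q t A B)
    (hB : Summable (fun n => qPoch x q n * qPoch y q n * e ^ n * B n))
    (hA : Summable (fun m => qPoch x q m * qPoch y q m * e ^ m
      / (qPoch (x * e) q m * qPoch (y * e) q m) * A m)) :
    ∑' n, qPoch x q n * qPoch y q n * e ^ n * B n
      = qPochInf (x * e) q * qPochInf (y * e) q / (qPochInf e q * qPochInf t q)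
        * ∑' m, qPoch x q m * qPoch y q m * e ^ m / (qPoch (x * e) q m * qPoch (y * e) q m)
          * A m := by
  subst hxy
  have hsub : ∀ n : ℕ, Filter.Tendsto (fun N : ℕ => N - n) Filter.atTop Filter.atTop :=
    fun n => Filter.tendsto_sub_atTop_nat n
  have hadd : ∀ n : ℕ, Filter.Tendsto (fun N : ℕ => N + n) Filter.atTop Filter.atTop :=
    fun n => Filter.tendsto_add_atTop_nat n
  have q0 := qPochInf_ne_zero hq hq
  have t0 := qPochInf_ne_zero ht hq
  have e0 := qPochInf_ne_zero he hq
  have h1 := tendsto_sum_range_mul (g := fun N n => qPoch e q (N - n) / qPoch q q (N - n)) hB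
    (by simpa only [div_eq_mul_inv] using (BoundedFamily.qPoch e hq _).mul (.inv_qPoch hq hq _))
    fun n => ((tendsto_qPoch e hq).comp (hsub n)).div ((tendsto_qPoch q hq).comp (hsub n)) q0
  have h2 := tendsto_sum_range_mul
    (g := fun N n => (qPoch q q (N - n))⁻¹ * (qPoch (x * y * e) q (N + n))⁻¹) hA
    ((BoundedFamily.inv_qPoch hq hq _).mul (.inv_qPoch ht hq _))
    fun n => (((tendsto_qPoch q hq).comp (hsub n)).inv₀ q0).mul
      (((tendsto_qPoch (x * y * e) hq).comp (hadd n)).inv₀ t0)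
  have h3 := ((tendsto_qPoch (x * e) hq).mul (tendsto_qPoch (y * e) hq)).mul h2
  -- The two sides of the finite lemma are the same sequence in `N`, so their limits agree.
  have h4 := tendsto_nhds_unique h1 (h3.congr fun N => by
    rw [h.sum_eq hq ht hx hy N]
    congr 1
    exact Finset.sum_congr rfl fun m _ => by
      rw [div_eq_mul_inv _ (qPoch q q (N - m) * _), mul_inv (qPoch q q (N - m))])
  field_simp at h4 ⊢
  linear_combination h4

/-! ### Rearrangement of sums -/

theorem summable_sum_antidiagonal {F : ℕ × ℕ → ℂ} (hF : Summable F) :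
    Summable (fun N => ∑ p ∈ Finset.HasAntidiagonal.antidiagonal N, F p) := by
  have h := (Finset.HasAntidiagonal.sigmaAntidiagonalEquivProd.summable_iff.mpr hF).sigma
  refine h.congr fun N => ?_
  rw [tsum_fintype, ← Finset.sum_coe_sort (Finset.HasAntidiagonal.antidiagonal N)]
  rfl

theorem tsum_sum_antidiagonal {F : ℕ × ℕ → ℂ} (hF : Summable F) :
    ∑' N, ∑ p ∈ Finset.HasAntidiagonal.antidiagonal N, F p = ∑' p, F p := by
  have h := Finset.HasAntidiagonal.sigmaAntidiagonalEquivProd.summable_iff.mpr hF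
  rw [← Finset.HasAntidiagonal.sigmaAntidiagonalEquivProd.tsum_eq F]
  refine Eq.trans ?_ h.tsum_sigma.symm
  refine tsum_congr fun N => ?_
  rw [tsum_fintype, ← Finset.sum_coe_sort (Finset.HasAntidiagonal.antidiagonal N)]
  rfl

theorem tsum_eq_tsum_two_mul {f : ℕ → ℂ} (hf : ∀ m, ¬ Even m → f m = 0) :
    ∑' m, f m = ∑' j, f (2 * j) := by
  have hinj : Function.Injective (fun j : ℕ => 2 * j) := fun i j h => by simpa using h
  refine (hinj.tsum_eq fun m hm => ?_).symm
  obtain ⟨k, hk⟩ : Even m := by_contra fun h => hm (hf m h)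
  exact ⟨k, by simp only; omega⟩

/-! ### Convergence of the series and matching of their terms -/

theorem qPoch_mul_qPoch_neg (w q : ℂ) (n : ℕ) :
    qPoch w q n * qPoch (-w) q n = qPoch (w ^ 2) (q ^ 2) n := by
  rw [qPoch, qPoch, qPoch, ← Finset.prod_mul_distrib]
  exact Finset.prod_congr rfl fun k _ => by ring

theorem qPoch_two_mul (a q : ℂ) (n : ℕ) :
    qPoch a q (2 * n) = qPoch a (q ^ 2) n * qPoch (a * q) (q ^ 2) n := by
  induction n with
  | zero => simp [qPoch_zero]
  | succ n ih =>
    rw [show 2 * (n + 1) = 2 * n + 1 + 1 by ring, qPoch_succ, qPoch_succ, ih, qPoch_succ,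
      qPoch_succ]
    ring

theorem boundedFamily_evenNumerator {q α : ℂ} (hq : ‖q‖ < 1) (hα : ‖q * α‖ < 1) :
    BoundedFamily (evenNumerator q α) := by
  have hq2 : ‖q ^ 2‖ < 1 := by rw [norm_pow]; exact pow_lt_one₀ (norm_nonneg _) hq (by norm_num)
  have b1 : BoundedFamily (fun j : ℕ => (-α) ^ j * q ^ (3 * j ^ 2 - j)) := by
    refine ⟨1, fun j => ?_⟩
    -- `|α|` may exceed 1, but `3j² - j ≥ j` supplies a factor `q^j`, turning `α^j` into `(qα)^j`.
    have hj : j ≤ j ^ 2 := Nat.le_self_pow (by norm_num) j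
    obtain ⟨l, hl⟩ : ∃ l, 3 * j ^ 2 - j = j + l := ⟨3 * j ^ 2 - j - j, by omega⟩
    simp only
    rw [hl, pow_add, ← mul_assoc, ← mul_pow, norm_mul, norm_pow, norm_pow,
      show ‖-α * q‖ = ‖q * α‖ by rw [neg_mul, norm_neg, mul_comm]]
    exact mul_le_one₀ (pow_le_one₀ (norm_nonneg _) hα.le) (by positivity)
      (pow_le_one₀ (norm_nonneg _) hq.le)
  have b2 : BoundedFamily (fun j : ℕ => 1 - α * q ^ (4 * j)) := by
    refine ⟨1 + ‖α‖ * 1, fun j => (norm_sub_le _ _).trans ?_⟩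
    rw [norm_one, norm_mul, norm_pow]
    gcongr
    exact pow_le_one₀ (norm_nonneg _) hq.le
  have b3 : BoundedFamily (fun _ : ℕ => (1 - α)⁻¹) := ⟨_, fun _ => le_rfl⟩
  obtain ⟨C, hC⟩ := ((((b1.mul b2).mul (.qPoch α hq2 id)).mul b3).mul
    (.inv_qPoch hq2 hq2 id))
  refine ⟨C, fun m => ?_⟩
  rw [evenNumerator]
  split_ifs
  · refine le_of_eq_of_le ?_ (hC (m / 2))
    congr 1
    simp only [id]
    rw [div_eq_mul_inv, mul_inv, mul_assoc _ (1 - α)⁻¹]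
  · rw [norm_zero]; exact (norm_nonneg _).trans (hC 0)

theorem norm_mul_lt_one {x y : ℂ} (hx : ‖x‖ < 1) (hy : ‖y‖ < 1) : ‖x * y‖ < 1 := by
  rw [norm_mul]
  exact mul_lt_one_of_nonneg_of_lt_one_left (norm_nonneg _) hx hy.le

/-- The double series with general term free of shifted parameters. -/
noncomputable def doubleSummand (q a b c d r t : ℂ) (p : ℕ × ℕ) : ℂ :=
  qPoch (a * b) q (p.1 + p.2) * qPoch (a * c) q (p.1 + p.2) * qPoch (a * d) q p.1
    * qPoch (a * r) q p.1 * qPoch (b * c) q p.2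
    * (qPoch (a * b * c * d) q (p.1 + p.2))⁻¹ * (qPoch (a * b * c * r) q (p.1 + p.2))⁻¹
    * (qPoch q q p.1)⁻¹ * (qPoch q q p.2)⁻¹ * (qPoch t (q ^ 2) p.1)⁻¹
    * ((b * c * d * r) ^ p.1 * (d * r) ^ p.2)

theorem summable_doubleSummand {q a b c d r t : ℂ} (hq : ‖q‖ < 1) (ha : ‖a‖ < 1) (hb : ‖b‖ < 1)
    (hc : ‖c‖ < 1) (hd : ‖d‖ < 1) (hr : ‖r‖ < 1) (ht : ‖t‖ < 1) :
    Summable (doubleSummand q a b c d r t) := by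
  have hq2 : ‖q ^ 2‖ < 1 := by rw [norm_pow]; exact pow_lt_one₀ (norm_nonneg _) hq (by norm_num)
  have habc := norm_mul_lt_one (norm_mul_lt_one ha hb) hc
  have hdr := norm_mul_lt_one hd hr
  have hg : Summable (fun p : ℕ × ℕ => ‖(b * c * d * r) ^ p.1 * (d * r) ^ p.2‖) := by
    simp only [norm_mul (_ ^ _)]
    exact (summable_norm_pow (norm_mul_lt_one (norm_mul_lt_one (norm_mul_lt_one hb hc) hd)
      hr)).mul_of_nonneg (summable_norm_pow hdr) (fun _ => norm_nonneg _) (fun _ => norm_nonneg _)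
  exact BoundedFamily.summable_mul (((((((((((BoundedFamily.qPoch _ hq _).mul (.qPoch _ hq _)).mul
    (.qPoch _ hq _)).mul (.qPoch _ hq _)).mul (.qPoch _ hq _)).mul
    (.inv_qPoch (norm_mul_lt_one habc hd) hq _)).mul
    (.inv_qPoch (norm_mul_lt_one habc hr) hq _)).mul (.inv_qPoch hq hq _)).mul
    (.inv_qPoch hq hq _)).mul (.inv_qPoch ht hq2 _))) hg

theorem summable_inner {q a b c d r : ℂ} (hq : ‖q‖ < 1) (ha : ‖a‖ < 1) (hb : ‖b‖ < 1)
    (hc : ‖c‖ < 1) (hd : ‖d‖ < 1) (hr : ‖r‖ < 1) (n : ℕ) :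
    Summable (qHypTerm ![a * b * q ^ n, a * c * q ^ n, b * c]
        ![a * b * c * d * q ^ n, a * b * c * r * q ^ n] q (d * r)) := by
  have hqn : ‖q ^ n‖ ≤ 1 := by rw [norm_pow]; exact pow_le_one₀ (norm_nonneg _) hq.le
  have habc := norm_mul_lt_one (norm_mul_lt_one ha hb) hc
  have h : ∀ z : ℂ, ‖z‖ < 1 → ‖z * q ^ n‖ < 1 := fun z hz => by
    rw [norm_mul]; exact mul_lt_one_of_nonneg_of_lt_one_left (norm_nonneg _) hz hqn
  refine (BoundedFamily.summable_mul ((((((BoundedFamily.qPoch (a * b * q ^ n) hq id).mul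
    (.qPoch (a * c * q ^ n) hq id)).mul (.qPoch (b * c) hq id)).mul (.inv_qPoch hq hq id)).mul
    (.inv_qPoch (h _ (norm_mul_lt_one habc hd)) hq id)).mul
    (.inv_qPoch (h _ (norm_mul_lt_one habc hr)) hq id))
    (summable_norm_pow (norm_mul_lt_one hd hr))).congr fun k => ?_
  simp only [qHypTerm, qPochs, Fin.prod_univ_succ, Fin.prod_univ_zero, div_eq_mul_inv, mul_inv, id]
  simp
  ring

/-- The parameters shifted by `q^n` merge with the outer factors through `(x)_n (x q^n)_k =
(x)_(n+k)`. -/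
theorem doubleSeriesTerm_eq_tsum {q a b c d r t w : ℂ} (hw : w ^ 2 = t) (n : ℕ) :
    doubleSeriesTerm q a b c d r w n = ∑' k, doubleSummand q a b c d r t (n, k) := by
  rw [doubleSeriesTerm, qHyp, ← tsum_mul_left]
  refine tsum_congr fun k => ?_
  rw [doubleSummand, ← hw, ← qPoch_mul_qPoch_neg]
  simp only [qPoch_add, qHypTerm, qPochs, Fin.prod_univ_succ, Fin.prod_univ_zero, div_eq_mul_inv,
    mul_inv]
  simp
  ring

/-- Splitting `(α;q)_{2j}` and `(q;q)_{2j}` into base `q²` leaves exactly the factors `(qα;q²)_j`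
and `(q;q²)_j`, which cancel in the series term. -/
theorem evenSeriesTerm_eq {q a b c d r α : ℂ} (hq : ‖q‖ < 1) (hα : ‖q * α‖ < 1) (j : ℕ) :
    qPoch (a * b) q (2 * j) * qPoch (a * c) q (2 * j) * (d * r) ^ (2 * j)
      / (qPoch (a * b * (d * r)) q (2 * j) * qPoch (a * c * (d * r)) q (2 * j))
      * (qPoch (a * d) q (2 * j) * qPoch (a * r) q (2 * j) * (b * c) ^ (2 * j)
      / (qPoch (a * d * (b * c)) q (2 * j) * qPoch (a * r * (b * c)) q (2 * j))
      * evenNumerator q α (2 * j)) = evenSeriesTerm q a b c d r α j := by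
  have hq2 : ‖q ^ 2‖ < 1 := by
    rw [norm_pow]; exact pow_lt_one₀ (norm_nonneg _) hq (by norm_num)
  have hu := qPoch_ne_zero hq hq2 j
  have hv := qPoch_ne_zero hα hq2 j
  rw [evenNumerator, if_pos (even_two_mul j), Nat.mul_div_cancel_left j two_pos, evenSeriesTerm]
  simp only [qPochs, Fin.prod_univ_succ, Fin.prod_univ_zero]
  simp only [Matrix.cons_val_zero, Matrix.cons_val_succ, mul_one]
  rw [qPoch_two_mul α, qPoch_two_mul q, mul_comm α q, ← pow_two q,
    show b * c * d * r = b * c * (d * r) by ring, mul_pow (b * c),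
    show a * d * (b * c) = a * b * c * d by ring, show a * r * (b * c) = a * b * c * r by ring,
    show a * b * (d * r) = a * b * d * r by ring, show a * c * (d * r) = a * c * d * r by ring]
  generalize qPoch q (q ^ 2) j = u at *
  generalize qPoch (q * α) (q ^ 2) j = v at *
  generalize qPoch (q ^ 2) (q ^ 2) j = f
  generalize qPoch α (q ^ 2) j = g
  generalize qPoch (a * b) q (2 * j) = e1
  generalize qPoch (a * c) q (2 * j) = e2
  generalize qPoch (a * d) q (2 * j) = e3
  generalize qPoch (a * r) q (2 * j) = e4
  generalize qPoch (a * b * c * d) q (2 * j) = e5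
  generalize qPoch (a * b * c * r) q (2 * j) = e6
  generalize qPoch (a * b * d * r) q (2 * j) = e7
  generalize qPoch (a * c * d * r) q (2 * j) = e8
  generalize (b * c) ^ (2 * j) = e9
  generalize (d * r) ^ (2 * j) = e10
  generalize 1 - α * q ^ (4 * j) = e11
  generalize 1 - α = e12
  simp only [div_eq_mul_inv, mul_inv]
  -- The only cancellations needed; with inverses kept as atoms, none of the other denominators has
  -- to be shown nonzero.
  have key (z : ℂ) : z * (u * u⁻¹) * (v * v⁻¹) = z := by
    rw [mul_inv_cancel₀ hu, mul_inv_cancel₀ hv, mul_one, mul_one]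
  refine (key _).symm.trans ?_
  ring

theorem sum_antidiagonal_doubleSummand (q a b c d r t : ℂ) (N : ℕ) :
    ∑ p ∈ Finset.HasAntidiagonal.antidiagonal N, doubleSummand q a b c d r t p
      = qPoch (a * b) q N * qPoch (a * c) q N * (d * r) ^ N *
        ((∑ n ∈ Finset.range (N + 1), qPoch (a * d) q n * qPoch (a * r) q n * (b * c) ^ n
          * (1 / (qPoch q q n * qPoch t (q ^ 2) n))
          * (qPoch (b * c) q (N - n) / qPoch q q (N - n)))
          / (qPoch (a * d * (b * c)) q N * qPoch (a * r * (b * c)) q N)) := by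
  rw [Finset.Nat.sum_antidiagonal_eq_sum_range_succ_mk, Finset.sum_div, Finset.mul_sum]
  refine Finset.sum_congr rfl fun n hn => ?_
  have hle : n ≤ N := Nat.lt_succ_iff.mp (Finset.mem_range.mp hn)
  rw [doubleSummand]
  simp only [Nat.add_sub_cancel' hle]
  rw [show (d * r) ^ N = (d * r) ^ n * (d * r) ^ (N - n) by
    rw [← pow_add, Nat.add_sub_cancel' hle], show b * c * d * r = b * c * (d * r) by ring,
    mul_pow (b * c), show a * d * (b * c) = a * b * c * d by ring,
    show a * r * (b * c) = a * b * c * r by ring]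
  simp only [div_eq_mul_inv, mul_inv]
  ring

/-- The two Bailey steps contribute `(dr)^m` and `(bc)^m`; their product is geometric and everything
else is bounded. -/
theorem summable_wellPoised {q a b c d r α : ℂ} (hq : ‖q‖ < 1) (ha : ‖a‖ < 1) (hb : ‖b‖ < 1)
    (hc : ‖c‖ < 1) (hd : ‖d‖ < 1) (hr : ‖r‖ < 1) (hα : ‖q * α‖ < 1) :
    Summable (fun m => qPoch (a * b) q m * qPoch (a * c) q m * (d * r) ^ m
      / (qPoch (a * b * (d * r)) q m * qPoch (a * c * (d * r)) q m)
      * (qPoch (a * d) q m * qPoch (a * r) q m * (b * c) ^ m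
      / (qPoch (a * d * (b * c)) q m * qPoch (a * r * (b * c)) q m)
      * evenNumerator q α m)) := by
  have hbc := norm_mul_lt_one hb hc
  have hdr := norm_mul_lt_one hd hr
  have hx1 := norm_mul_lt_one (norm_mul_lt_one ha hd) hbc
  have hy1 := norm_mul_lt_one (norm_mul_lt_one ha hr) hbc
  have hx2 := norm_mul_lt_one (norm_mul_lt_one ha hb) hdr
  have hy2 := norm_mul_lt_one (norm_mul_lt_one ha hc) hdr
  refine (BoundedFamily.summable_mul (((((((((BoundedFamily.qPoch (a * b) hq id).mul
    (.qPoch (a * c) hq id)).mul (.inv_qPoch hx2 hq id)).mul (.inv_qPoch hy2 hq id)).mul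
    (.qPoch (a * d) hq id)).mul (.qPoch (a * r) hq id)).mul (.inv_qPoch hx1 hq id)).mul
    (.inv_qPoch hy1 hq id)).mul (boundedFamily_evenNumerator hq hα))
    (summable_norm_pow (norm_mul_lt_one hbc hdr))).congr fun m => ?_
  simp only [div_eq_mul_inv, mul_inv, mul_pow (b * c), id]
  ring

theorem double_series_identity {q a b c d r α w : ℂ} (hq : ‖q‖ < 1) (ha : ‖a‖ < 1)
    (hb : ‖b‖ < 1) (hc : ‖c‖ < 1) (hd : ‖d‖ < 1) (hr : ‖r‖ < 1)
    (hα : q * α = a ^ 2 * b * c * d * r) (hα1 : α ≠ 1) (hw : w ^ 2 = q * α) :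
    Summable (doubleSeriesTerm q a b c d r w) ∧ Summable (evenSeriesTerm q a b c d r α) ∧
    ∑' n : ℕ, doubleSeriesTerm q a b c d r w n
      = qPochsInf ![a * b * d * r, a * c * d * r] q / qPochsInf ![d * r, q * α] q
        * ∑' n : ℕ, evenSeriesTerm q a b c d r α n := by
  have hbc := norm_mul_lt_one hb hc
  have hdr := norm_mul_lt_one hd hr
  have hx1 := norm_mul_lt_one (norm_mul_lt_one ha hd) hbc
  have hy1 := norm_mul_lt_one (norm_mul_lt_one ha hr) hbc
  have hx2 := norm_mul_lt_one (norm_mul_lt_one ha hb) hdr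
  have hy2 := norm_mul_lt_one (norm_mul_lt_one ha hc) hdr
  -- These two factorizations of `a²bcdr` let both Bailey steps be taken relative to the same `α`.
  have ht1 : q * α = a * d * (a * r) * (b * c) := by rw [hα]; ring
  have ht2 : q * α = a * b * (a * c) * (d * r) := by rw [hα]; ring
  have hn2 := norm_mul_lt_one (norm_mul_lt_one (norm_mul_lt_one ha hb) (norm_mul_lt_one ha hc)) hdr
  have hn : ‖q * α‖ < 1 := ht2 ▸ hn2
  have hF := summable_doubleSummand hq ha hb hc hd hr hn
  have hterm := doubleSeriesTerm_eq_tsum (q := q) (a := a) (b := b) (c := c) (d := d) (r := r) hw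
  have p0 := isBaileyPair_evenNumerator hq hn hα1
  have p1 := p0.next ht1 hq hn hx1 hy1
  have hB := sum_antidiagonal_doubleSummand q a b c d r (q * α)
  have hE := evenSeriesTerm_eq (a := a) (b := b) (c := c) (d := d) (r := r) hq hn
  have hA := summable_wellPoised hq ha hb hc hd hr hn
  have hinj : Function.Injective (fun j : ℕ => 2 * j) := fun i j h => by simpa using h
  have hsum : Summable (doubleSeriesTerm q a b c d r w) := hF.prod.congr fun n => (hterm n).symm
  refine ⟨hsum, (hA.comp_injective hinj).congr hE, ?_⟩
  have hfin := p1.tsum_eq ht2 hq hn hdr hx2 hy2 ((summable_sum_antidiagonal hF).congr hB) hA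
  rw [tsum_congr hterm, ← hF.tsum_prod, ← tsum_sum_antidiagonal hF, tsum_congr hB, hfin,
    tsum_eq_tsum_two_mul fun m hm => by simp only [evenNumerator, if_neg hm, mul_zero],
    tsum_congr hE]
  simp [qPochsInf, Fin.prod_univ_succ, mul_assoc]

theorem theorem6p6 (q : ℝ) (hq0 : 0 < q) (hq1 : q < 1)
    (a b c d r : ℂ) (ha : ‖a‖ < 1) (hb : ‖b‖ < 1) (hc : ‖c‖ < 1) (hd : ‖d‖ < 1) (hr : ‖r‖ < 1)
    (α : ℂ) (hα : α = a ^ 2 * b * c * d * r / (q : ℂ)) (hα1 : α ≠ 1)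
    (w : ℂ) (hw : w ^ 2 = (q : ℂ) * α) :
    (∀ n : ℕ, Summable (qHypTerm ![a * b * (q : ℂ) ^ n, a * c * (q : ℂ) ^ n, b * c]
        ![a * b * c * d * (q : ℂ) ^ n, a * b * c * r * (q : ℂ) ^ n] (q : ℂ) (d * r))) ∧
    Summable (doubleSeriesTerm (q : ℂ) a b c d r w) ∧
    Summable (evenSeriesTerm (q : ℂ) a b c d r α) ∧
    ∑' n : ℕ, doubleSeriesTerm (q : ℂ) a b c d r w n
      = qPochsInf ![a * b * d * r, a * c * d * r] (q : ℂ)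
          / qPochsInf ![d * r, (q : ℂ) * α] (q : ℂ)
        * ∑' n : ℕ, evenSeriesTerm (q : ℂ) a b c d r α n := by
  have hq : ‖(q : ℂ)‖ < 1 := by rwa [Complex.norm_real, Real.norm_of_nonneg hq0.le]
  have hα' : (q : ℂ) * α = a ^ 2 * b * c * d * r := by
    rw [hα, mul_div_cancel₀ _ (Complex.ofReal_ne_zero.mpr hq0.ne')]
  exact ⟨summable_inner hq ha hb hc hd hr,
    double_series_identity hq ha hb hc hd hr hα' hα1 hw⟩
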